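/- **Codes.** An $[n,k,d]_q$ linear code is a $k$-dimensional subspace of $\mathbb F_q^n$ with minimum Hamming distance $d$. It has *all symbol $(r,\delta)$-locality* if every coordinate $j$ lies in a set $S$ of at most $r+\delta-1$ coordinates such that the code punctured to $S$ has minimum distance at least $\delta$. Such a code is called *optimal* if $$d=n-k+1-\Big(\Big\lceil \frac kr\Big\rceil-1\Big)(\delta-1).$$ **Union-intersection-bounded families.** Let $n_1\ge\tau\ge 2$, $\tau\ge\delta\ge1$, $t\ge s\ge 1$. An $(s,t;\delta)$-UIBF$(\tau,n_1)$ is a pair $(\mathcal X,\mathcal S)$ where $|\mathcal X|=n_1$, $\mathcal S$ is a collection of $\tau$-subsets of $\mathcal X$, and $\big|(\bigcup_{i\le s}A_i)\cap(\bigcup_{i\le t}B_i)\big|<\delta$ for any $s+t$ distinct $A_1,\dots,A_s,B_1,\dots,B_t\in\mathcal S$. **Construction A.** Let $\delta\ge 1$, $1\le v\le r$, $w\ge1$, $n=w(r+\delta-1)$, $k=(w-1)r+v$. Let $\alpha_1,\dots,\alpha_{r-v}\in\mathbb F_q$ be distinct, and let $S_i=\{\theta_{i,1},\dots,\theta_{i,r+\delta-1}\}\subseteq\mathbb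 F_q\setminus\{\alpha_1,\dots,\alpha_{r-v}\}$, $1\le i\le w$, be sets of $r+\delta-1$ elements. Given information symbols $I_{i,t}\in\mathbb F_q$ ($1\le t\le r$ for $i<w$, and $1\le t\le v$ for $i=w$), for $i<w$ let $f_i$ be the polynomial of degree at most $r-1$ with $f_i(\theta_{i,t})=I_{i,t}$ for $1\le t\le r$; let $f_w$ be the polynomial of degree at most $r-1$ with $f_w(\theta_{w,t})=I_{w,t}$ for $1\le t\le v$ and $$\sum_{i=1}^{w}\frac{f_i(\alpha_t)}{\prod_{\theta\in S_i}(\alpha_t-\theta)}=0\qquad(1\le t\le r-v).$$ The code $\mathcal C$ consists of all words $(f_i(\theta_{i,t}))_{1\le i\le w,\ 1\le t\le r+\delta-1}$ obtained in this way. **Statement.** 1. Let $\mu$ be a positive integer with $\mu\delta\ge r-v$. Suppose that the sets $S_1,\dots,S_w$ are pairwise distinct, that $w\ge\mu$, and that $(\mathbb F_q\setminus\{\alpha_1,\dots,\alpha_{r-v}\},\{S_1,\dots,S_w\})$ is a $(1,\mu-1;\delta)$-UIBF$(r+\delta-1,\,q-r+v)$. Then $\mathcal C$ is an optimal $[n,k,d]_q$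 linear code with all symbol $(r,\delta)$-locality and $d=r-v+\delta$. 2. For all integers $r\ge1$, $\delta\ge1$, $\mu\ge2$ there are a constant $c>0$ and an integer $q_0$, depending only on $r,\delta,\mu$, such that for every $v$ with $1\le v\le r$ and $\mu\delta\ge r-v$ and every prime power $q\ge q_0$, there are a number $w\ge1$ and points and sets $\alpha_t,S_i$ as above over $\mathbb F_q$ for which Construction A generates an optimal $[n,k,d]_q$ linear code with all symbol $(r,\delta)$-locality, $n=w(r+\delta-1)$, $k=(w-1)r+v$, $d=r-v+\delta$, and $$n\ \ge\ c\,q^{\delta/(\mu-1)}.$$ -/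

import Mathlib

open Polynomial

universe u

/-! ### Linear codes, minimum distance, `(r, δ)`-locality, optimality

A linear code with coordinates indexed by a finite type `ι` is a subspace `C` of `ι → F`; its length
is `Fintype.card ι`. -/

section Codes

variable {F : Type*} [Field F] [DecidableEq F] {ι : Type*} [Fintype ι]

/-- The minimum Hamming distance of `C` is at least `d`. -/
def MinDistGE (C : Submodule F (ι → F)) (d : ℕ) : Prop :=
  ∀ x ∈ C, ∀ y ∈ C, x ≠ y → d ≤ hammingDist x y

/-- The minimum Hamming distance of `C` is (attained and) exactly `d`. -/
def HasMinDist (C : Submodule F (ι → F)) (d : ℕ) : Prop :=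
  IsLeast {e : ℕ | ∃ x ∈ C, ∃ y ∈ C, x ≠ y ∧ hammingDist x y = e} d

/-- The punctured code `C|_S`: all coordinates outside `S` are deleted. -/
def puncturedCode (C : Submodule F (ι → F)) (S : Finset ι) : Submodule F (S → F) :=
  C.map (LinearMap.funLeft F F (Subtype.val : S → ι))

/-- The code symbol with index `j` has `(r, δ)`-locality: it lies in an `(r, δ)`-repair set. -/
def HasLocality (C : Submodule F (ι → F)) (r δ : ℕ) (j : ι) : Prop :=
  ∃ S : Finset ι, j ∈ S ∧ S.card ≤ r + δ - 1 ∧ MinDistGE (puncturedCode C S) δ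

/-- All symbol `(r, δ)`-locality. -/
def AllSymbolLocality (C : Submodule F (ι → F)) (r δ : ℕ) : Prop :=
  ∀ j : ι, HasLocality C r δ j

/-- The Singleton-type bound `n - k + 1 - (⌈k / r⌉ - 1)(δ - 1)` on the minimum Hamming distance. -/
def singletonTypeBound (n k r δ : ℕ) : ℤ :=
  (n : ℤ) - k + 1 - (⌈(k : ℚ) / (r : ℚ)⌉ - 1) * ((δ : ℤ) - 1)

/-- `C` is an `[n, k, d]` linear code with all symbol `(r, δ)`-locality which is optimal, i.e. its
minimum Hamming distance attains the Singleton-type bound with equality. -/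
structure IsOptimalLRC (C : Submodule F (ι → F)) (n k d r δ : ℕ) : Prop where
  length_eq : Fintype.card ι = n
  dim_eq : Module.finrank F C = k
  minDist_eq : HasMinDist C d
  locality : AllSymbolLocality C r δ
  attains_bound : (d : ℤ) = singletonTypeBound n k r δ

end Codes

/-! ### Union-intersection-bounded families -/

/-- `(X, B)` is an `(s, t; δ)`-UIBF`(τ, n₁)`: `X` is a set of `n₁` points, `B` is a collection of
`τ`-subsets of `X`, and for any `s + t` distinct blocks `A₁, …, Aₛ, B₁, …, Bₜ`, the union of the `Aᵢ`
and the union of the `Bᵢ` meet in fewer than `δ` points. -/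
structure IsUIBF {P : Type*} [DecidableEq P] (s t δ τ n₁ : ℕ)
    (X : Finset P) (B : Finset (Finset P)) : Prop where
  s_pos : 0 < s
  s_le_t : s ≤ t
  δ_pos : 0 < δ
  δ_le_τ : δ ≤ τ
  two_le_τ : 2 ≤ τ
  τ_le_n₁ : τ ≤ n₁
  card_points : X.card = n₁
  block_subset : ∀ A ∈ B, A ⊆ X
  block_card : ∀ A ∈ B, A.card = τ
  inter_card_lt : ∀ (A : Fin s → Finset P) (A' : Fin t → Finset P),
    (∀ i, A i ∈ B) → (∀ i, A' i ∈ B) → Function.Injective (Sum.elim A A') →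
      ((Finset.univ.biUnion A) ∩ (Finset.univ.biUnion A')).card < δ

/-! ### Construction A

The number of blocks is `w = m + 1`; the blocks with index `i.castSucc`, `i : Fin m`, are
`S₁, …, S_{w-1}`, and the block with index `Fin.last m` is `S_w`. -/

/-- The evaluation points of Construction A over `F`: the elements `θ i t` of the sets `S_i`, and the
elements `α t`, which lie outside all the sets `S_i`. -/
structure EvalData (F : Type*) (m r δ v : ℕ) where
  θ : Fin (m + 1) → Fin (r + δ - 1) → F
  α : Fin (r - v) → F
  θ_injective : ∀ i, Function.Injective (θ i)
  α_injective : Function.Injective α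
  θ_ne_α : ∀ i t s, θ i t ≠ α s

namespace EvalData

set_option linter.unusedSectionVars false

variable {F : Type*} [Field F] [DecidableEq F] {m r δ v : ℕ}

/-- The evaluation set `S_i`. -/
def block (D : EvalData F m r δ v) (i : Fin (m + 1)) : Finset F :=
  Finset.univ.image (D.θ i)

/-- The set `F ∖ {α_t}`. -/
def points [Fintype F] (D : EvalData F m r δ v) : Finset F :=
  Finset.univ \ Finset.univ.image D.α

/-- `∏_{θ ∈ S_i} (α_t - θ)`. -/
def denom (D : EvalData F m r δ v) (i : Fin (m + 1)) (t : Fin (r - v)) : F :=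
  ∏ x ∈ D.block i, (D.α t - x)

/-- Step 1: for `i < w`, the polynomial `f_i` of degree less than `r` with `f_i(θ_{i,t}) = I_{i,t}` for
the first `r` points of `S_i`. -/
noncomputable def localPoly (D : EvalData F m r δ v) (hδ : 1 ≤ δ)
    (I : (Fin m → Fin r → F) × (Fin v → F)) (i : Fin m) : F[X] :=
  Lagrange.interpolate Finset.univ
    (fun t : Fin r => D.θ i.castSucc (Fin.castLE (by omega) t)) (I.1 i)

/-- Step 2: the auxiliary symbols `a_{i,t} = f_i(α_t) / ∏_{θ ∈ S_i} (α_t - θ)` for `i < w`. -/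
noncomputable def auxSymbol (D : EvalData F m r δ v) (hδ : 1 ≤ δ)
    (I : (Fin m → Fin r → F) × (Fin v → F)) (i : Fin m) (t : Fin (r - v)) : F :=
  (D.localPoly hδ I i).eval (D.α t) / D.denom i.castSucc t

/-- Step 3: the polynomial `f_w` of degree less than `v + (r - v) = r` with `f_w(θ_{w,t}) = I_{w,t}` for
the first `v` points of `S_w`, and `f_w(α_t) / ∏_{θ ∈ S_w} (α_t - θ) = a_{w,t}` for all `t`, where
`a_{w,t} = - ∑_{i < w} a_{i,t}`, i.e. `∑_{i ≤ w} a_{i,t} = 0`. -/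
noncomputable def lastPoly (D : EvalData F m r δ v) (hδ : 1 ≤ δ) (hv : v ≤ r)
    (I : (Fin m → Fin r → F) × (Fin v → F)) : F[X] :=
  Lagrange.interpolate Finset.univ
    (Sum.elim (fun t : Fin v => D.θ (Fin.last m) (Fin.castLE (by omega) t)) D.α)
    (Sum.elim I.2 (fun t => (-∑ i : Fin m, D.auxSymbol hδ I i t) * D.denom (Fin.last m) t))

/-- All the polynomials `f_1, …, f_w`. -/
noncomputable def poly (D : EvalData F m r δ v) (hδ : 1 ≤ δ) (hv : v ≤ r)
    (I : (Fin m → Fin r → F) × (Fin v → F)) : Fin (m + 1) → F[X] :=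
  Fin.snoc (α := fun _ => F[X]) (D.localPoly hδ I) (D.lastPoly hδ hv I)

theorem localPoly_add (D : EvalData F m r δ v) (hδ : 1 ≤ δ)
    (I J : (Fin m → Fin r → F) × (Fin v → F)) (i : Fin m) :
    D.localPoly hδ (I + J) i = D.localPoly hδ I i + D.localPoly hδ J i := by
  unfold localPoly
  rw [← map_add]
  rfl

theorem localPoly_smul (D : EvalData F m r δ v) (hδ : 1 ≤ δ) (c : F)
    (I : (Fin m → Fin r → F) × (Fin v → F)) (i : Fin m) :
    D.localPoly hδ (c • I) i = c • D.localPoly hδ I i := by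
  unfold localPoly
  rw [← map_smul]
  rfl

theorem lastPoly_add (D : EvalData F m r δ v) (hδ : 1 ≤ δ) (hv : v ≤ r)
    (I J : (Fin m → Fin r → F) × (Fin v → F)) :
    D.lastPoly hδ hv (I + J) = D.lastPoly hδ hv I + D.lastPoly hδ hv J := by
  unfold lastPoly
  rw [← map_add]
  congr 1
  funext x
  rcases x with t | t
  · rfl
  · simp only [Sum.elim_inr, Pi.add_apply, auxSymbol, localPoly_add, eval_add, add_div,
      Finset.sum_add_distrib]
    ring

theorem lastPoly_smul (D : EvalData F m r δ v) (hδ : 1 ≤ δ) (hv : v ≤ r) (c : F)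
    (I : (Fin m → Fin r → F) × (Fin v → F)) :
    D.lastPoly hδ hv (c • I) = c • D.lastPoly hδ hv I := by
  unfold lastPoly
  rw [← map_smul]
  congr 1
  funext x
  rcases x with t | t
  · rfl
  · simp only [Sum.elim_inr, Pi.smul_apply, auxSymbol, localPoly_smul, eval_smul, smul_eq_mul,
      mul_div_assoc, ← Finset.mul_sum]
    ring

/-- The encoding map `I ↦ C(I)`, with `c_{i,t} = f_i(θ_{i,t})`. -/
noncomputable def encode (D : EvalData F m r δ v) (hδ : 1 ≤ δ) (hv : v ≤ r) :
    ((Fin m → Fin r → F) × (Fin v → F)) →ₗ[F] (Fin (m + 1) × Fin (r + δ - 1) → F) where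
  toFun I p := (D.poly hδ hv I p.1).eval (D.θ p.1 p.2)
  map_add' I J := by
    funext p
    obtain ⟨i, t⟩ := p
    refine Fin.lastCases ?_ (fun j => ?_) i <;>
      simp [poly, localPoly_add, lastPoly_add]
  map_smul' c I := by
    funext p
    obtain ⟨i, t⟩ := p
    refine Fin.lastCases ?_ (fun j => ?_) i <;>
      simp [poly, localPoly_smul, lastPoly_smul]

/-- The code generated by Construction A. -/
noncomputable def code (D : EvalData F m r δ v) (hδ : 1 ≤ δ) (hv : v ≤ r) :
    Submodule F (Fin (m + 1) × Fin (r + δ - 1) → F) :=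
  LinearMap.range (D.encode hδ hv)

end EvalData

/-! Everything reduces to the lower bound on the distance, `card_add_le_sum_card_eval_ne_zero`. Each
nonzero `f i` has at least `δ` nonzero values on its block, so more than `μ` nonzero `f i` already
give enough weight. Otherwise, cancel the zeros of each `f i` on `S i` against the denominator and
clear what remains: the parity checks say that one numerator `N` vanishes on `A`. Separation leaves
a point where exactly one summand of `N` survives, so `N ≠ 0` and `|A| ≤ deg N ≤ weight - δ`.

For long codes, split part of the field into `r + δ - 1` groups of `p` points and let a block pick
one point from each group. Blocks then meet only where their rows of choices agree, and the deletion
method (`exists_rows_few_agreements`) supplies about `p ^ (δ / (μ - 1))` separated rows, with `p` of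
order `q`. -/

/-! ### Weight bound for families of polynomials -/

section PolynomialZeros

variable {F : Type*} [Field F] [DecidableEq F]

/-- A nonzero polynomial splits off its zeros in a finite set, and what is left has small degree. -/
theorem Polynomial.exists_eq_nodal_mul {f : F[X]} (hf : f ≠ 0) (S : Finset F) :
    ∃ h : F[X], f = Lagrange.nodal {x ∈ S | f.eval x = 0} id * h ∧
      h.natDegree + S.card = f.natDegree + {x ∈ S | f.eval x ≠ 0}.card := by
  obtain ⟨h, hh⟩ : Lagrange.nodal {x ∈ S | f.eval x = 0} id ∣ f := by
    refine Finset.prod_dvd_of_coprime ?_ ?_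
    · intro a _ b _ hab
      exact isCoprime_X_sub_C_of_isUnit_sub (sub_ne_zero.2 hab).isUnit
    · intro a ha
      exact dvd_iff_isRoot.2 (Finset.mem_filter.1 ha).2
  refine ⟨h, hh, ?_⟩
  have hh0 : h ≠ 0 := by
    rintro rfl
    exact hf (by rw [hh, mul_zero])
  have hd := congrArg natDegree hh
  rw [natDegree_mul (Lagrange.nodal_ne_zero) hh0, Lagrange.natDegree_nodal] at hd
  have hc := Finset.card_filter_add_card_filter_not (s := S) (fun x => f.eval x = 0)
  simp only [ne_eq]
  omega

/-- A nonzero polynomial of degree less than `r` is nonzero at `δ` or more of `r + δ - 1` points. -/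
theorem Polynomial.le_card_eval_ne_zero {f : F[X]} (hf : f ≠ 0) {r δ : ℕ} (hdeg : f.degree < r)
    {S : Finset F} (hS : S.card = r + δ - 1) :
    δ ≤ {x ∈ S | f.eval x ≠ 0}.card := by
  obtain ⟨h, -, hh⟩ := Polynomial.exists_eq_nodal_mul hf S
  have := (natDegree_lt_iff_degree_lt hf).2 hdeg
  omega

/-- Let `f i` be polynomials of degree less than `r` whose combination
`∑ i, f i / ∏ x ∈ S i, (X - x)` vanishes on `A`. If the sets `S i` of size `r + δ - 1` are separated,
then the `f i` have at least `|A| + δ` nonzero values on the sets `S i` in total. -/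
theorem card_add_le_sum_card_eval_ne_zero {ι : Type*} [Fintype ι] [DecidableEq ι] {r δ μ : ℕ}
    (S : ι → Finset F) (hS : ∀ i, (S i).card = r + δ - 1)
    (hsep : ∀ (i : ι) (J : Finset ι), i ∉ J → J.card < μ → (S i ∩ J.biUnion S).card < δ)
    (A : Finset F) (hA : A.card ≤ μ * δ) (hAS : ∀ i, Disjoint A (S i))
    (f : ι → F[X]) (hdeg : ∀ i, (f i).degree < r) (hf : f ≠ 0)
    (hsum : ∀ a ∈ A, ∑ i, (f i).eval a / ∏ x ∈ S i, (a - x) = 0) :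
    A.card + δ ≤ ∑ i, {x ∈ S i | (f i).eval x ≠ 0}.card := by
  classical
  set J : Finset ι := {i | f i ≠ 0} with hJ
  set P : ι → Finset F := fun i => {x ∈ S i | (f i).eval x ≠ 0} with hP
  have hmem : ∀ {i}, i ∈ J ↔ f i ≠ 0 := by simp [hJ]
  have hPδ : ∀ i ∈ J, δ ≤ (P i).card := fun i hi =>
    Polynomial.le_card_eval_ne_zero (hmem.1 hi) (hdeg i) (hS i)
  have hsub : ∑ i ∈ J, (P i).card ≤ ∑ i, (P i).card :=
    Finset.sum_le_sum_of_subset (Finset.subset_univ _)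
  refine le_trans ?_ hsub
  -- Separation is needed only when at most `μ` of the polynomials are nonzero.
  obtain hlt | hle := lt_or_ge μ J.card
  · calc A.card + δ ≤ (μ + 1) * δ := by linarith
      _ ≤ J.card * δ := Nat.mul_le_mul_right _ hlt
      _ ≤ ∑ i ∈ J, (P i).card := by
        simpa using Finset.card_nsmul_le_sum J (fun i => (P i).card) δ hPδ
  have hex : ∀ i, ∃ h : F[X], f i = Lagrange.nodal {x ∈ S i | (f i).eval x = 0} id * h ∧
      (i ∈ J → h.natDegree + δ ≤ (P i).card) := by
    intro i
    by_cases hi : f i = 0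
    · exact ⟨0, by simp [hi], fun h => absurd hi (hmem.1 h)⟩
    · obtain ⟨h, h1, h2⟩ := Polynomial.exists_eq_nodal_mul hi (S i)
      refine ⟨h, h1, fun _ => ?_⟩
      have h3 := (natDegree_lt_iff_degree_lt hi).2 (hdeg i)
      have h4 := hS i
      have h5 : (P i).card = {x ∈ S i | (f i).eval x ≠ 0}.card := rfl
      omega
  choose h hfh hhdeg using hex
  -- After cancellation the `i`-th fraction is `h i / nodal (P i)`; `N` is the numerator over the
  -- common denominator.
  set N : F[X] := ∑ i ∈ J, h i * ∏ j ∈ J.erase i, Lagrange.nodal (P j) id with hN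
  have hsplit : ∀ i a, ∏ x ∈ S i, (a - x) =
      (Lagrange.nodal {x ∈ S i | (f i).eval x = 0} id).eval a * (Lagrange.nodal (P i) id).eval a := by
    intro i a
    rw [Lagrange.eval_nodal, Lagrange.eval_nodal]
    exact (Finset.prod_filter_mul_prod_filter_not _ _ _).symm
  -- the numerator vanishes on `A`
  have hroot : ∀ a ∈ A, N.eval a = 0 := by
    intro a ha
    have hne : ∀ i, ∏ x ∈ S i, (a - x) ≠ 0 := fun i => Finset.prod_ne_zero_iff.2 fun x hx =>
      sub_ne_zero.2 fun hax => Finset.disjoint_left.1 (hAS i) ha (hax ▸ hx)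
    have hterm : ∀ i ∈ J, (h i * ∏ j ∈ J.erase i, Lagrange.nodal (P j) id).eval a =
        (∏ j ∈ J, (Lagrange.nodal (P j) id).eval a) * ((f i).eval a / ∏ x ∈ S i, (a - x)) := by
      intro i hi
      have h0 := hne i
      rw [hsplit] at h0 ⊢
      have e : (f i).eval a =
          (Lagrange.nodal {x ∈ S i | (f i).eval x = 0} id).eval a * (h i).eval a := by
        conv_lhs => rw [hfh i]
        rw [eval_mul]
      rw [e, mul_div_mul_left _ _ (left_ne_zero_of_mul h0), ← Finset.mul_prod_erase J _ hi, eval_mul,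
        eval_prod]
      have := right_ne_zero_of_mul h0
      field_simp
    rw [hN, eval_finsetSum, Finset.sum_congr rfl hterm, ← Finset.mul_sum]
    have : ∑ i ∈ J, (f i).eval a / ∏ x ∈ S i, (a - x) = 0 := by
      rw [← hsum a ha]
      refine Finset.sum_subset (Finset.subset_univ _) fun i _ hi => ?_
      have : f i = 0 := by simpa [hJ] using hi
      simp [this]
    rw [this, mul_zero]
  obtain ⟨i, hi⟩ : ∃ i, i ∈ J := by
    obtain ⟨i, hi⟩ := Function.ne_iff.1 hf
    exact ⟨i, hmem.2 hi⟩
  -- the numerator does not vanish at a point of `S i` outside the other sets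
  have hN0 : N ≠ 0 := by
    have hcard := hsep i (J.erase i) (Finset.notMem_erase i J) (by
      rw [Finset.card_erase_of_mem hi]
      have := Finset.card_pos.2 ⟨i, hi⟩
      omega)
    obtain ⟨β, hβP, hβ⟩ : ∃ β ∈ P i, β ∉ (J.erase i).biUnion S := by
      by_contra! hcon
      have : P i ⊆ S i ∩ (J.erase i).biUnion S := fun x hx =>
        Finset.mem_inter.2 ⟨(Finset.mem_filter.1 hx).1, hcon x hx⟩
      exact absurd ((hPδ i hi).trans (Finset.card_le_card this)) (not_le.2 hcard)
    intro hzero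
    have hev : N.eval β = 0 := by rw [hzero, eval_zero]
    rw [hN, eval_finsetSum, Finset.sum_eq_single_of_mem i hi] at hev
    · rw [eval_mul, eval_prod] at hev
      rcases mul_eq_zero.1 hev with h1 | h1
      · refine (Finset.mem_filter.1 hβP).2 ?_
        rw [hfh i, eval_mul, h1, mul_zero]
      · obtain ⟨j, hj, hj0⟩ := Finset.prod_eq_zero_iff.1 h1
        rw [Lagrange.eval_nodal, Finset.prod_eq_zero_iff] at hj0
        obtain ⟨x, hx, hx0⟩ := hj0
        refine hβ (Finset.mem_biUnion.2 ⟨j, hj, ?_⟩)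
        have : β = x := sub_eq_zero.1 hx0
        exact this ▸ (Finset.mem_filter.1 hx).1
    · intro j hj hji
      rw [eval_mul, eval_prod]
      refine mul_eq_zero_of_right _
        (Finset.prod_eq_zero (Finset.mem_erase.2 ⟨hji.symm, hi⟩) ?_)
      exact Lagrange.eval_nodal_at_node (v := id) hβP
  have hNdeg : N.natDegree + δ ≤ ∑ i ∈ J, (P i).card := by
    have hterm : ∀ i ∈ J, (h i * ∏ j ∈ J.erase i, Lagrange.nodal (P j) id).natDegree + δ ≤
        ∑ i ∈ J, (P i).card := by
      intro i hi
      have h1 := natDegree_mul_le (p := h i) (q := ∏ j ∈ J.erase i, Lagrange.nodal (P j) id)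
      have h2 := natDegree_prod_le (J.erase i) (fun j => Lagrange.nodal (P j) (id : F → F))
      simp only [Lagrange.natDegree_nodal] at h2
      have h3 := Finset.add_sum_erase J (fun i => (P i).card) hi
      have h4 := hhdeg i hi
      omega
    have := natDegree_sum_le_of_forall_le (n := (∑ i ∈ J, (P i).card) - δ) J
      (fun i => h i * ∏ j ∈ J.erase i, Lagrange.nodal (P j) id)
      (fun i hi => Nat.le_sub_of_add_le (hterm i hi))
    -- One term shows that the total is at least `δ`, so the truncated subtraction is harmless.
    have h1 := hterm i hi
    have h2 : N.natDegree ≤ (∑ i ∈ J, (P i).card) - δ := this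
    omega
  have : A.card ≤ N.natDegree := by
    by_contra! hcon
    exact hN0 (eq_zero_of_natDegree_lt_card_of_eval_eq_zero' N A hroot hcon)
  omega

end PolynomialZeros

/-! ### Deletion method -/

/-- For fixed source rows, the arrays whose row `i` copies, at each place `t ∈ T`, the entry of another
row form at most a `p ^ |T|`-th part of all arrays. -/
theorem card_filter_copies_mul_le {ι κ A : Type*} [Fintype ι] [Fintype κ] [Fintype A]
    [DecidableEq ι] [DecidableEq κ] [DecidableEq A] (i : ι) (T : Finset κ) (s : κ → ι)
    (hs : ∀ t, s t ≠ i) :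
    (Finset.card {ω : ι → κ → A | ∀ t ∈ T, ω i t = ω (s t) t}) * Fintype.card A ^ T.card ≤
      Fintype.card (ι → κ → A) := by
  classical
  have hT : Fintype.card A ^ T.card = (Finset.univ : Finset (T → A)).card := by
    simp
  rw [hT, ← Finset.card_product, ← Finset.card_univ]
  -- Overwriting row `i` on `T` by arbitrary symbols is injective: the lost entries can be read off
  -- from the source rows, which are untouched.
  refine Finset.card_le_card_of_injOn
    (fun x j t => if h : j = i ∧ t ∈ T then x.2 ⟨t, h.2⟩ else x.1 j t) (by simp) ?_
  rintro ⟨ω, z⟩ h1 ⟨ω', z'⟩ h2 heq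
  simp only [Finset.coe_product, Finset.coe_filter, Finset.mem_univ, true_and, Finset.coe_univ,
    Set.mem_prod, Set.mem_ofPred_eq, Set.mem_univ, and_true] at h1 h2
  have hval : ∀ j t, (if h : j = i ∧ t ∈ T then z ⟨t, h.2⟩ else ω j t) =
      (if h : j = i ∧ t ∈ T then z' ⟨t, h.2⟩ else ω' j t) := fun j t =>
    congrFun (congrFun heq j) t
  have hω : ∀ j t, ¬ (j = i ∧ t ∈ T) → ω j t = ω' j t := by
    intro j t h
    simpa [h] using hval j t
  refine Prod.ext ?_ ?_
  · funext j t
    by_cases h : j = i ∧ t ∈ T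
    · obtain ⟨rfl, ht⟩ := h
      change ω j t = ω' j t
      rw [h1 t ht, h2 t ht]
      exact hω _ _ fun h => hs t h.1
    · exact hω j t h
  · funext t
    simpa using hval i t

/-- Deletion method: among `N` suitable rows of length `τ` over `p` symbols, at least half of them
agree with any `l` others together in fewer than `δ` places. -/
theorem exists_rows_few_agreements {N τ p l δ : ℕ} (hp : 0 < p) (hl : 0 < l)
    (hN : 2 * (2 ^ τ * l ^ τ) * N ^ l ≤ p ^ δ) :
    ∃ (ω : Fin N → Fin τ → Fin p) (G : Finset (Fin N)), N ≤ 2 * G.card ∧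
      ∀ i ∈ G, ∀ g : Fin l → Fin N, (∀ j, g j ≠ i) →
        (Finset.card {t | ∃ j, ω i t = ω (g j) t}) < δ := by
  classical
  -- A configuration is a certificate of failure: a row, `l` competitors, the places of agreement,
  -- and the competitor matched at each place.
  let Cfg := Fin N × (Fin l → Fin N) × Finset (Fin τ) × (Fin τ → Fin l)
  let bad : (Fin N → Fin τ → Fin p) → Cfg → Prop := fun ω c =>
    (∀ j, c.2.1 j ≠ c.1) ∧ c.2.2.1.card = δ ∧
      ∀ t ∈ c.2.2.1, ω c.1 t = ω (c.2.1 (c.2.2.2 t)) t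
  have hcount : ∀ c : Cfg, (Finset.card {ω | bad ω c}) * p ^ δ ≤
      Fintype.card (Fin N → Fin τ → Fin p) := by
    rintro ⟨i, g, T, h⟩
    by_cases hc : (∀ j, g j ≠ i) ∧ T.card = δ
    · have := card_filter_copies_mul_le (A := Fin p) i T (fun t => g (h t)) (fun t => hc.1 _)
      rw [hc.2, Fintype.card_fin] at this
      refine le_trans (Nat.mul_le_mul_right _ (Finset.card_le_card ?_)) this
      intro ω hω
      simp only [bad, Finset.mem_filter, Finset.mem_univ, true_and] at hω ⊢
      exact hω.2.2
    · have : ({ω | bad ω (i, g, T, h)} : Finset (Fin N → Fin τ → Fin p)) = ∅ := by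
        refine Finset.filter_eq_empty_iff.2 fun ω _ hω => hc ⟨hω.1, hω.2.1⟩
      rw [this]
      simp
  have hCfg : Fintype.card Cfg = N * (N ^ l * (2 ^ τ * l ^ τ)) := by
    simp [Cfg, Fintype.card_prod]
  have hsum : ∑ ω : Fin N → Fin τ → Fin p, 2 * (Finset.card {c : Cfg | bad ω c}) ≤
      ∑ _ω : Fin N → Fin τ → Fin p, N := by
    have hswap : ∑ ω : Fin N → Fin τ → Fin p, (Finset.card {c : Cfg | bad ω c}) =
        ∑ c : Cfg, (Finset.card {ω | bad ω c}) := by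
      simp only [Finset.card_filter]
      exact Finset.sum_comm
    rw [← Finset.mul_sum, hswap, Finset.sum_const, Finset.card_univ, smul_eq_mul]
    refine Nat.le_of_mul_le_mul_right ?_ (pow_pos hp δ)
    have h1 : (∑ c : Cfg, (Finset.card {ω | bad ω c})) * p ^ δ ≤
        Fintype.card Cfg * Fintype.card (Fin N → Fin τ → Fin p) := by
      rw [Finset.sum_mul]
      simpa using Finset.sum_le_card_nsmul Finset.univ _ _ (fun c _ => hcount c)
    calc 2 * (∑ c : Cfg, (Finset.card {ω | bad ω c})) * p ^ δ
        ≤ 2 * (Fintype.card Cfg * Fintype.card (Fin N → Fin τ → Fin p)) := by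
          rw [mul_assoc]; exact Nat.mul_le_mul_left 2 h1
      _ = Fintype.card (Fin N → Fin τ → Fin p) * N * (2 * (2 ^ τ * l ^ τ) * N ^ l) := by
          rw [hCfg]; ring
      _ ≤ _ := Nat.mul_le_mul_left _ hN
  obtain ⟨ω, -, hω⟩ := Finset.exists_le_of_sum_le
    (⟨fun _ _ => ⟨0, hp⟩, Finset.mem_univ _⟩ : (Finset.univ : Finset (Fin N → Fin τ → Fin p)).Nonempty)
    hsum
  -- An array with at most `N / 2` bad configurations; delete the first row of each.
  refine ⟨ω, (({c : Cfg | bad ω c} : Finset Cfg).image Prod.fst)ᶜ, ?_, ?_⟩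
  · rw [Finset.card_compl, Fintype.card_fin]
    have := Finset.card_image_le (s := ({c : Cfg | bad ω c} : Finset Cfg)) (f := Prod.fst)
    omega
  · intro i hi g hg
    by_contra! hcon
    obtain ⟨T, hT, hTδ⟩ := Finset.exists_subset_card_eq hcon
    have hch : ∀ t ∈ T, ∃ j, ω i t = ω (g j) t := fun t ht => (Finset.mem_filter.1 (hT ht)).2
    refine Finset.mem_compl.1 hi (Finset.mem_image.2 ?_)
    have hch' : ∀ t, ∃ j, t ∈ T → ω i t = ω (g j) t := fun t => by
      by_cases ht : t ∈ T
      · obtain ⟨j, hj⟩ := hch t ht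
        exact ⟨j, fun _ => hj⟩
      · exact ⟨⟨0, hl⟩, fun h => absurd h ht⟩
    choose h hh using hch'
    exact ⟨(i, g, T, h), by simpa [bad, hg, hTδ] using hh, rfl⟩

/-! ### Parameters of the code -/

namespace EvalData

set_option linter.unusedSectionVars false

variable {F : Type*} [Field F] [DecidableEq F] {m r δ v : ℕ}

theorem card_block (D : EvalData F m r δ v) (i : Fin (m + 1)) :
    (D.block i).card = r + δ - 1 := by
  simp [block, Finset.card_image_of_injective _ (D.θ_injective i)]

theorem denom_ne_zero (D : EvalData F m r δ v) (i : Fin (m + 1)) (t : Fin (r - v)) :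
    D.denom i t ≠ 0 := by
  refine Finset.prod_ne_zero_iff.2 fun x hx => sub_ne_zero.2 ?_
  obtain ⟨s, -, rfl⟩ := Finset.mem_image.1 hx
  exact (D.θ_ne_α i s t).symm

theorem localNodes_injective (D : EvalData F m r δ v) {a : ℕ} (h : a ≤ r + δ - 1)
    (i : Fin (m + 1)) : Function.Injective fun t : Fin a => D.θ i (Fin.castLE h t) :=
  (D.θ_injective i).comp (Fin.castLE_injective _)

theorem lastNodes_injective (D : EvalData F m r δ v) (h : v ≤ r + δ - 1) :
    Function.Injective
      (Sum.elim (fun t : Fin v => D.θ (Fin.last m) (Fin.castLE h t)) D.α) :=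
  (D.localNodes_injective h _).sumElim D.α_injective fun _ _ => D.θ_ne_α _ _ _

@[simp]
theorem poly_castSucc (D : EvalData F m r δ v) (hδ : 1 ≤ δ) (hv : v ≤ r)
    (I : (Fin m → Fin r → F) × (Fin v → F)) (i : Fin m) :
    D.poly hδ hv I i.castSucc = D.localPoly hδ I i := by
  simp [poly]

@[simp]
theorem poly_last (D : EvalData F m r δ v) (hδ : 1 ≤ δ) (hv : v ≤ r)
    (I : (Fin m → Fin r → F) × (Fin v → F)) :
    D.poly hδ hv I (Fin.last m) = D.lastPoly hδ hv I := by
  simp [poly]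

theorem degree_poly_lt (D : EvalData F m r δ v) (hδ : 1 ≤ δ) (hv : v ≤ r)
    (I : (Fin m → Fin r → F) × (Fin v → F)) (i : Fin (m + 1)) :
    (D.poly hδ hv I i).degree < r := by
  refine Fin.lastCases ?_ (fun j => ?_) i
  · rw [poly_last]
    have := Lagrange.degree_interpolate_lt (s := Finset.univ)
      (Sum.elim I.2 (fun t => (-∑ i : Fin m, D.auxSymbol hδ I i t) * D.denom (Fin.last m) t))
      (D.lastNodes_injective (by omega)).injOn
    have hc : (Finset.univ : Finset (Fin v ⊕ Fin (r - v))).card = r := by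
      simp [hv]
    rwa [hc] at this
  · rw [poly_castSucc]
    have := Lagrange.degree_interpolate_lt (s := Finset.univ) (I.1 j)
      (D.localNodes_injective (a := r) (by omega) j.castSucc).injOn
    rwa [Finset.card_univ, Fintype.card_fin] at this

theorem eval_localPoly (D : EvalData F m r δ v) (hδ : 1 ≤ δ)
    (I : (Fin m → Fin r → F) × (Fin v → F)) (i : Fin m) (t : Fin r) :
    (D.localPoly hδ I i).eval (D.θ i.castSucc (Fin.castLE (by omega) t)) = I.1 i t :=
  Lagrange.eval_interpolate_at_node (I.1 i)
    (D.localNodes_injective (a := r) (by omega) i.castSucc).injOn (Finset.mem_univ t)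

theorem eval_lastPoly (D : EvalData F m r δ v) (hδ : 1 ≤ δ) (hv : v ≤ r)
    (I : (Fin m → Fin r → F) × (Fin v → F)) (t : Fin v) :
    (D.lastPoly hδ hv I).eval (D.θ (Fin.last m) (Fin.castLE (by omega) t)) = I.2 t :=
  Lagrange.eval_interpolate_at_node (i := Sum.inl t) _
    (D.lastNodes_injective (by omega)).injOn (Finset.mem_univ _)

theorem eval_lastPoly_α (D : EvalData F m r δ v) (hδ : 1 ≤ δ) (hv : v ≤ r)
    (I : (Fin m → Fin r → F) × (Fin v → F)) (t : Fin (r - v)) :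
    (D.lastPoly hδ hv I).eval (D.α t) =
      (-∑ i : Fin m, D.auxSymbol hδ I i t) * D.denom (Fin.last m) t :=
  Lagrange.eval_interpolate_at_node (i := Sum.inr t) _
    (D.lastNodes_injective (by omega)).injOn (Finset.mem_univ _)

/-- The global parity checks. -/
theorem sum_eval_div_denom (D : EvalData F m r δ v) (hδ : 1 ≤ δ) (hv : v ≤ r)
    (I : (Fin m → Fin r → F) × (Fin v → F)) (t : Fin (r - v)) :
    ∑ i, (D.poly hδ hv I i).eval (D.α t) / D.denom i t = 0 := by
  rw [Fin.sum_univ_castSucc, poly_last, eval_lastPoly_α,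
    mul_div_cancel_right₀ _ (D.denom_ne_zero _ _)]
  simp [auxSymbol]

theorem encode_apply (D : EvalData F m r δ v) (hδ : 1 ≤ δ) (hv : v ≤ r)
    (I : (Fin m → Fin r → F) × (Fin v → F)) (p : Fin (m + 1) × Fin (r + δ - 1)) :
    D.encode hδ hv I p = (D.poly hδ hv I p.1).eval (D.θ p.1 p.2) := rfl

/-- The encoding is systematic: the information symbols are themselves coordinates of the word. -/
theorem encode_injective (D : EvalData F m r δ v) (hδ : 1 ≤ δ) (hv : v ≤ r) :
    Function.Injective (D.encode hδ hv) := by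
  intro I J hIJ
  refine Prod.ext ?_ ?_
  · funext i t
    rw [← D.eval_localPoly hδ I i t, ← D.eval_localPoly hδ J i t, ← D.poly_castSucc hδ hv,
      ← D.poly_castSucc hδ hv]
    exact congrFun hIJ (i.castSucc, _)
  · funext t
    rw [← D.eval_lastPoly hδ hv I t, ← D.eval_lastPoly hδ hv J t, ← D.poly_last hδ hv,
      ← D.poly_last hδ hv]
    exact congrFun hIJ (Fin.last m, _)

theorem finrank_code (D : EvalData F m r δ v) (hδ : 1 ≤ δ) (hv : v ≤ r) :
    Module.finrank F (D.code hδ hv) = m * r + v := by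
  rw [code, LinearMap.finrank_range_of_inj (D.encode_injective hδ hv)]
  simp [Module.finrank_prod, Module.finrank_pi_fintype]

theorem card_block_eval_ne_zero (D : EvalData F m r δ v) (f : F[X]) (i : Fin (m + 1)) :
    {x ∈ D.block i | f.eval x ≠ 0}.card =
      (Finset.univ.filter fun t => f.eval (D.θ i t) ≠ 0).card := by
  rw [block, Finset.filter_image, Finset.card_image_of_injective _ (D.θ_injective i)]

theorem hammingNorm_encode (D : EvalData F m r δ v) (hδ : 1 ≤ δ) (hv : v ≤ r)
    (I : (Fin m → Fin r → F) × (Fin v → F)) :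
    hammingNorm (D.encode hδ hv I) =
      ∑ i, {x ∈ D.block i | (D.poly hδ hv I i).eval x ≠ 0}.card := by
  simp_rw [card_block_eval_ne_zero, hammingNorm, Finset.card_filter, Fintype.sum_prod_type]
  rfl

/-- Each block meets the union of fewer than `μ` other blocks in fewer
than `δ` points. -/
def Separated (D : EvalData F m r δ v) (μ : ℕ) : Prop :=
  ∀ (i : Fin (m + 1)) (J : Finset (Fin (m + 1))), i ∉ J → J.card < μ →
    (D.block i ∩ J.biUnion D.block).card < δ

theorem le_hammingNorm_encode (D : EvalData F m r δ v) (hδ : 1 ≤ δ) (hv : v ≤ r) {μ : ℕ}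
    (hμ : r - v ≤ μ * δ) (hD : D.Separated μ) {I : (Fin m → Fin r → F) × (Fin v → F)}
    (hI : I ≠ 0) : r - v + δ ≤ hammingNorm (D.encode hδ hv I) := by
  have hα : (Finset.univ.image D.α).card = r - v := by
    simp [Finset.card_image_of_injective _ D.α_injective]
  have := card_add_le_sum_card_eval_ne_zero D.block D.card_block hD (Finset.univ.image D.α)
    (by rwa [hα]) ?_ (D.poly hδ hv I) (D.degree_poly_lt hδ hv I) ?_ ?_
  · rwa [hα, ← hammingNorm_encode] at this
  · intro i
    refine Finset.disjoint_left.2 fun x hx hx' => ?_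
    obtain ⟨t, -, rfl⟩ := Finset.mem_image.1 hx
    obtain ⟨s, -, hs⟩ := Finset.mem_image.1 hx'
    exact D.θ_ne_α _ _ _ hs
  · intro h0
    refine hI (D.encode_injective hδ hv ?_)
    funext p
    rw [map_zero, encode_apply, h0]
    simp
  · intro a ha
    obtain ⟨t, -, rfl⟩ := Finset.mem_image.1 ha
    exact D.sum_eval_div_denom hδ hv I t

/-- The word of the unit vector at the last information symbol has low weight. -/
theorem exists_hammingNorm_encode_le (D : EvalData F m r δ v) (hδ : 1 ≤ δ) (hv1 : 1 ≤ v)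
    (hv : v ≤ r) : ∃ I, I ≠ 0 ∧ hammingNorm (D.encode hδ hv I) ≤ r - v + δ := by
  let last : Fin v := ⟨v - 1, by omega⟩
  -- Only the last block is nonzero, and there the first `v - 1` of the `r + δ - 1` values vanish.
  refine ⟨(0, Pi.single last 1), ?_, ?_⟩
  · intro h
    have := congrFun (congrArg Prod.snd h) last
    simp at this
  · set I : (Fin m → Fin r → F) × (Fin v → F) := (0, Pi.single last 1) with hI
    have hloc : ∀ i, D.localPoly hδ I i = 0 := fun i => by
      simp [localPoly, hI]
    rw [hammingNorm_encode, Fin.sum_univ_castSucc, poly_last]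
    simp only [poly_castSucc, hloc, eval_zero, ne_eq, not_true_eq_false, Finset.filter_false,
      Finset.card_empty, Finset.sum_const_zero, zero_add]
    have h1 := Finset.card_filter_add_card_filter_not (s := D.block (Fin.last m))
      (fun x => (D.lastPoly hδ hv I).eval x = 0)
    rw [card_block] at h1
    have h2 : v - 1 ≤ {x ∈ D.block (Fin.last m) | (D.lastPoly hδ hv I).eval x = 0}.card := by
      have hinj := D.localNodes_injective (a := v - 1) (by omega) (Fin.last m)
      rw [← Fintype.card_fin (v - 1), ← Finset.card_univ,
        ← Finset.card_image_of_injective _ hinj]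
      refine Finset.card_le_card fun x hx => ?_
      obtain ⟨t, -, rfl⟩ := Finset.mem_image.1 hx
      refine Finset.mem_filter.2 ⟨Finset.mem_image_of_mem _ (Finset.mem_univ _), ?_⟩
      have := D.eval_lastPoly hδ hv I (Fin.castLE (by omega) t)
      rw [Fin.castLE_castLE] at this
      rw [this, hI]
      refine Pi.single_eq_of_ne (fun h => ?_) _
      have h3 := congrArg Fin.val h
      have h4 := t.2
      simp only [Fin.val_castLE, last] at h3
      omega
    omega

theorem hasMinDist_code (D : EvalData F m r δ v) (hδ : 1 ≤ δ) (hv1 : 1 ≤ v) (hv : v ≤ r) {μ : ℕ}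
    (hμ : r - v ≤ μ * δ) (hD : D.Separated μ) : HasMinDist (D.code hδ hv) (r - v + δ) := by
  have hlow : ∀ x ∈ D.code hδ hv, ∀ y ∈ D.code hδ hv, x ≠ y → r - v + δ ≤ hammingDist x y := by
    rintro _ ⟨I, rfl⟩ _ ⟨J, rfl⟩ hIJ
    rw [hammingDist_eq_hammingNorm, ← map_neg, ← map_add]
    refine D.le_hammingNorm_encode hδ hv hμ hD fun h => hIJ ?_
    rw [neg_add_eq_zero.1 h]
  refine ⟨?_, ?_⟩
  · obtain ⟨I, hI, hle⟩ := D.exists_hammingNorm_encode_le hδ hv1 hv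
    have hne : D.encode hδ hv I ≠ 0 := fun h =>
      hI (D.encode_injective hδ hv (h.trans (map_zero _).symm))
    refine ⟨_, ⟨I, rfl⟩, 0, zero_mem _, hne, le_antisymm ?_ ?_⟩
    · rwa [hammingDist_zero_right]
    · exact hlow _ ⟨I, rfl⟩ 0 (zero_mem _) hne
  · rintro e ⟨x, hx, y, hy, hxy, rfl⟩
    exact hlow x hx y hy hxy

/-- Each block is a repair set: on it, words are values of polynomials of degree less than `r` at `r
+ δ - 1` points. -/
theorem allSymbolLocality_code (D : EvalData F m r δ v) (hδ : 1 ≤ δ) (hv : v ≤ r) :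
    AllSymbolLocality (D.code hδ hv) r δ := by
  rintro ⟨i, t⟩
  refine ⟨Finset.univ.map ⟨fun t => (i, t), Prod.mk_right_injective i⟩, by simp, by simp, ?_⟩
  rintro _ ⟨_, ⟨I, rfl⟩, rfl⟩ _ ⟨_, ⟨J, rfl⟩, rfl⟩ hne
  have hval : ∀ s, D.encode hδ hv I (i, s) - D.encode hδ hv J (i, s) =
      (D.poly hδ hv (I - J) i).eval (D.θ i s) := fun s => by
    rw [← Pi.sub_apply, ← map_sub]
    rfl
  have h0 : D.poly hδ hv (I - J) i ≠ 0 := by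
    intro h0
    refine hne (funext ?_)
    rintro ⟨⟨j, s⟩, hs⟩
    obtain ⟨s', -, hs'⟩ := Finset.mem_map.1 hs
    obtain ⟨rfl, rfl⟩ := Prod.mk.inj hs'
    have := hval s'
    rw [h0, eval_zero, sub_eq_zero] at this
    exact this
  have hδle := Polynomial.le_card_eval_ne_zero h0 (D.degree_poly_lt hδ hv _ i) (D.card_block i)
  rw [card_block_eval_ne_zero] at hδle
  refine hδle.trans ?_
  unfold hammingDist
  refine Finset.card_le_card_of_injOn (fun s => ⟨(i, s), by simp⟩) ?_ ?_
  · intro s hs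
    simp only [Finset.coe_filter, Finset.mem_univ, true_and, Set.mem_ofPred_eq] at hs ⊢
    rw [← hval, sub_ne_zero] at hs
    exact hs
  · intro s _ s' _ h
    simpa using h

theorem cast_eq_singletonTypeBound (m : ℕ) {r δ v : ℕ} (hδ : 1 ≤ δ) (hv1 : 1 ≤ v) (hv : v ≤ r) :
    ((r - v + δ : ℕ) : ℤ) = singletonTypeBound ((m + 1) * (r + δ - 1)) (m * r + v) r δ := by
  have hr : (0 : ℚ) < r := by exact_mod_cast hv1.trans hv
  have hceil : ⌈((m * r + v : ℕ) : ℚ) / r⌉ = (m : ℤ) + 1 := by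
    rw [Int.ceil_eq_iff, lt_div_iff₀ hr, div_le_iff₀ hr]
    have h1 : (1 : ℚ) ≤ v := by exact_mod_cast hv1
    have h2 : (v : ℚ) ≤ r := by exact_mod_cast hv
    push_cast
    constructor <;> linarith
  rw [singletonTypeBound, hceil]
  push_cast [Nat.cast_sub hv, Nat.cast_sub (show 1 ≤ r + δ by omega)]
  ring

theorem isOptimalLRC_code (D : EvalData F m r δ v) (hδ : 1 ≤ δ) (hv1 : 1 ≤ v) (hv : v ≤ r) {μ : ℕ}
    (hμ : r - v ≤ μ * δ) (hD : D.Separated μ) :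
    IsOptimalLRC (D.code hδ hv) ((m + 1) * (r + δ - 1)) (m * r + v) (r - v + δ) r δ where
  length_eq := by simp
  dim_eq := D.finrank_code hδ hv
  minDist_eq := D.hasMinDist_code hδ hv1 hv hμ hD
  locality := D.allSymbolLocality_code hδ hv
  attains_bound := cast_eq_singletonTypeBound m hδ hv1 hv

/-- The family condition concerns exactly `μ - 1` further blocks, so a smaller `J` is padded with
other indices; `μ ≤ m + 1` leaves room, and injectivity keeps the blocks distinct. -/
theorem separated_of_isUIBF [Fintype F] (D : EvalData F m r δ v) {μ n₁ : ℕ}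
    (hinj : Function.Injective D.block) (hμ : μ ≤ m + 1)
    (h : IsUIBF 1 (μ - 1) δ (r + δ - 1) n₁ D.points (Finset.univ.image D.block)) :
    D.Separated μ := by
  intro i J hi hJ
  obtain ⟨J', hJJ', hJ'i, hcard⟩ := Finset.exists_subsuperset_card_eq (n := μ - 1)
    (show J ⊆ Finset.univ.erase i from fun j hj =>
      Finset.mem_erase.2 ⟨fun hji => hi (hji ▸ hj), Finset.mem_univ _⟩) (by omega) (by
      rw [Finset.card_erase_of_mem (Finset.mem_univ _), Finset.card_univ, Fintype.card_fin]
      omega)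
  let e := J'.orderIsoOfFin hcard
  have hlt := h.inter_card_lt (fun _ => D.block i) (fun j => D.block (e j))
    (fun _ => Finset.mem_image_of_mem _ (Finset.mem_univ _))
    (fun _ => Finset.mem_image_of_mem _ (Finset.mem_univ _))
    (Function.Injective.sumElim (Function.injective_of_subsingleton _)
      (hinj.comp (Subtype.val_injective.comp e.injective)) fun _ j hj => by
        have := hJ'i (e j).2
        rw [← hinj hj] at this
        exact Finset.notMem_erase _ _ this)
  refine lt_of_le_of_lt (Finset.card_le_card fun x hx => ?_) hlt
  obtain ⟨hx1, hx2⟩ := Finset.mem_inter.1 hx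
  obtain ⟨j, hj, hxj⟩ := Finset.mem_biUnion.1 hx2
  refine Finset.mem_inter.2 ⟨Finset.mem_biUnion.2 ⟨0, Finset.mem_univ _, hx1⟩,
    Finset.mem_biUnion.2 ⟨e.symm ⟨j, hJJ' hj⟩, Finset.mem_univ _, ?_⟩⟩
  simpa using hxj

end EvalData

/-! ### Long codes over large fields -/

/-- Rows with few agreements give separated evaluation sets: the points of `F` are arranged in `τ`
groups of `p` points, and every block is a transversal of the groups. -/
theorem exists_evalData_separated (F : Type*) [Field F] [Fintype F] [DecidableEq F]
    {r δ v l p N : ℕ} (hδ : 1 ≤ δ) (hl : 0 < l) (hp : 0 < p) (hN0 : 0 < N)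
    (hN : 2 * (2 ^ (r + δ - 1) * l ^ (r + δ - 1)) * N ^ l ≤ p ^ δ)
    (hF : r - v + (r + δ - 1) * p ≤ Fintype.card F) :
    ∃ (m : ℕ) (D : EvalData F m r δ v), D.Separated (l + 1) ∧ N ≤ 2 * (m + 1) := by
  obtain ⟨ω, G, hG, hω⟩ := exists_rows_few_agreements hp hl hN
  obtain ⟨φ⟩ : Nonempty (Fin (r - v) ⊕ Fin (r + δ - 1) × Fin p ↪ F) :=
    Function.Embedding.nonempty_of_card_le (by simpa using hF)
  obtain ⟨m, hm⟩ : ∃ m, G.card = m + 1 := ⟨G.card - 1, by omega⟩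
  let e := G.orderIsoOfFin hm
  refine ⟨m, ⟨fun i t => φ (Sum.inr (t, ω (e i) t)), fun t => φ (Sum.inl t), ?_, ?_, ?_⟩, ?_,
    by omega⟩
  · intro i t t' h
    exact congrArg Prod.fst (Sum.inr.inj (φ.injective h))
  · exact φ.injective.comp Sum.inl_injective
  · intro i t s h
    exact Sum.inr_ne_inl (φ.injective h)
  · intro i J hi hJ
    obtain rfl | ⟨j₀, hj₀⟩ := J.eq_empty_or_nonempty
    · simpa using (show 0 < δ from hδ)
    -- `J` may have fewer than `l` elements; `Function.invFun ψ` lists it with repetitions.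
    obtain ⟨ψ⟩ : Nonempty (J ↪ Fin l) :=
      Function.Embedding.nonempty_of_card_le (by simpa using Nat.le_of_lt_succ hJ)
    have : Nonempty J := ⟨⟨j₀, hj₀⟩⟩
    have hlt := hω (e i) (e i).2 (fun j => e (Function.invFun ψ j).1) fun j hj => by
      have h1 := e.injective (Subtype.val_injective hj)
      exact hi (h1 ▸ (Function.invFun ψ j).2)
    refine lt_of_le_of_lt ?_ hlt
    refine le_trans (Finset.card_le_card fun x hx => ?_)
      (Finset.card_image_le (f := fun t => φ (Sum.inr (t, ω (e i) t))))
    obtain ⟨hx1, hx2⟩ := Finset.mem_inter.1 hx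
    obtain ⟨t, -, rfl⟩ := Finset.mem_image.1 hx1
    obtain ⟨j, hj, hxj⟩ := Finset.mem_biUnion.1 hx2
    obtain ⟨s, -, hs⟩ := Finset.mem_image.1 hxj
    refine Finset.mem_image_of_mem _ (Finset.mem_filter.2 ⟨Finset.mem_univ _, ψ ⟨j, hj⟩, ?_⟩)
    obtain ⟨rfl, h2⟩ := Prod.mk.inj (Sum.inr.inj (φ.injective hs))
    rw [Function.leftInverse_invFun ψ.injective]
    exact h2.symm

/-- Numbers of rows and symbols that suit the deletion method over fields of large size `q`. -/
theorem exists_deletion_parameters (r δ l : ℕ) (hr : 1 ≤ r) (hδ : 1 ≤ δ) (hl : 0 < l) :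
    ∃ c : ℝ, 0 < c ∧ ∃ q₀ : ℕ, ∀ q : ℕ, q₀ ≤ q → ∃ p N : ℕ, 0 < p ∧ 0 < N ∧
      2 * (2 ^ (r + δ - 1) * l ^ (r + δ - 1)) * N ^ l ≤ p ^ δ ∧
      r + (r + δ - 1) * p ≤ q ∧ c * (q : ℝ) ^ ((δ : ℝ) / l) ≤ N := by
  set τ := r + δ - 1 with hτ
  have hτ1 : 1 ≤ τ := by omega
  set K : ℕ := 2 * (2 ^ τ * l ^ τ) with hK
  have hK1 : 1 ≤ K := Nat.one_le_iff_ne_zero.2 (by positivity)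
  have hlR : (0 : ℝ) < l := by exact_mod_cast hl
  have hδR : (0 : ℝ) < δ := by exact_mod_cast hδ
  have hB1 : (1 : ℝ) ≤ K * (2 * τ) ^ δ := by
    refine one_le_mul_of_one_le_of_one_le (by exact_mod_cast hK1) (one_le_pow₀ ?_)
    have : (1 : ℝ) ≤ τ := by exact_mod_cast hτ1
    linarith
  -- Chosen so that `q ≤ 2 * τ * p` turns `K * (q ^ δ / B)` into at most `p ^ δ`.
  set B : ℝ := K * (2 * τ) ^ δ with hB
  have hB0 : 0 < B := by linarith
  have htend := (tendsto_rpow_atTop (div_pos hδR hlR)).comp (tendsto_natCast_atTop_atTop (R := ℝ))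
  obtain ⟨q₁, hq₁⟩ := Filter.eventually_atTop.1 (htend.eventually_ge_atTop B)
  -- `q₁` gives `1 ≤ x`, so rounding `x` down loses at most the factor `2`; `2 * (r + τ) ≤ q` gives
  -- `q ≤ 2 * τ * p`.
  refine ⟨B⁻¹ / 2, by positivity, max q₁ (2 * (r + τ)), fun q hq => ?_⟩
  have hqB : B ≤ (q : ℝ) ^ ((δ : ℝ) / l) := hq₁ q (le_trans (le_max_left _ _) hq)
  have hq2 : 2 * (r + τ) ≤ q := le_trans (le_max_right _ _) hq
  set x : ℝ := B⁻¹ * (q : ℝ) ^ ((δ : ℝ) / l) with hx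
  have hx1 : 1 ≤ x := by
    rw [hx, inv_mul_eq_div, one_le_div hB0]
    exact hqB
  have hdiv := Nat.div_add_mod (q - r) τ
  have hmod := Nat.mod_lt (q - r) hτ1
  have hp2 : q ≤ 2 * τ * ((q - r) / τ) := by
    rw [mul_assoc]
    omega
  refine ⟨(q - r) / τ, ⌊x⌋₊, Nat.div_pos (by omega) hτ1, Nat.floor_pos.2 hx1, ?_, by omega, ?_⟩
  · have hpow : x ^ l ≤ B⁻¹ * (q : ℝ) ^ δ := by
      rw [hx, mul_pow, ← Real.rpow_natCast (_ ^ _) l, ← Real.rpow_mul (Nat.cast_nonneg q),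
        div_mul_cancel₀ _ hlR.ne', Real.rpow_natCast]
      refine mul_le_mul_of_nonneg_right ?_ (by positivity)
      exact pow_le_of_le_one (by positivity) (inv_le_one_of_one_le₀ hB1) hl.ne'
    have hfin : (K : ℝ) * (⌊x⌋₊ : ℝ) ^ l ≤ (((q - r) / τ : ℕ) : ℝ) ^ δ := by
      have hq3 : (q : ℝ) ≤ 2 * τ * ((q - r) / τ : ℕ) := by exact_mod_cast hp2
      calc (K : ℝ) * (⌊x⌋₊ : ℝ) ^ l ≤ K * x ^ l := by
            gcongr
            exact Nat.floor_le (by linarith)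
        _ ≤ K * (B⁻¹ * (2 * τ * ((q - r) / τ : ℕ)) ^ δ) := by
            gcongr
            exact hpow.trans (by gcongr)
        _ = (B⁻¹ * (K * (2 * τ) ^ δ)) * (((q - r) / τ : ℕ) : ℝ) ^ δ := by
            rw [mul_pow]; ring
        _ = _ := by rw [← hB, inv_mul_cancel₀ hB0.ne', one_mul]
    exact_mod_cast hfin
  · have := Nat.lt_floor_add_one x
    have h1 : (1 : ℝ) ≤ ⌊x⌋₊ := by exact_mod_cast Nat.floor_pos.2 hx1
    have h2 : B⁻¹ / 2 * (q : ℝ) ^ ((δ : ℝ) / l) = x / 2 := by rw [hx]; ring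
    rw [h2]
    linarith

theorem mainTheorem11 :
    (∀ (F : Type u) [Field F] [Fintype F] [DecidableEq F] (m r δ v μ : ℕ)
      (hδ : 1 ≤ δ) (_hv1 : 1 ≤ v) (hv : v ≤ r) (D : EvalData F m r δ v),
      Function.Injective D.block →
      μ ≤ m + 1 →
      r - v ≤ μ * δ →
      IsUIBF 1 (μ - 1) δ (r + δ - 1) (Fintype.card F - (r - v))
        D.points (Finset.univ.image D.block) →
      IsOptimalLRC (D.code hδ hv)
        ((m + 1) * (r + δ - 1)) (m * r + v) (r - v + δ) r δ) ∧
    (∀ (r δ μ : ℕ) (hδ : 1 ≤ δ), 1 ≤ r → 2 ≤ μ →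
      ∃ c : ℝ, 0 < c ∧ ∃ q₀ : ℕ,
        ∀ (v : ℕ) (_hv1 : 1 ≤ v) (hv : v ≤ r), r - v ≤ μ * δ →
        ∀ (F : Type u) [Field F] [Fintype F] [DecidableEq F], q₀ ≤ Fintype.card F →
          ∃ (m : ℕ) (D : EvalData F m r δ v),
            IsOptimalLRC (D.code hδ hv)
              ((m + 1) * (r + δ - 1)) (m * r + v) (r - v + δ) r δ ∧
            c * (Fintype.card F : ℝ) ^ ((δ : ℝ) / ((μ : ℝ) - 1)) ≤
              (((m + 1) * (r + δ - 1) : ℕ) : ℝ)) := by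
  refine ⟨?_, ?_⟩
  · intro F _ _ _ m r δ v μ hδ hv1 hv D hinj hμ hμδ hU
    exact D.isOptimalLRC_code hδ hv1 hv hμδ (D.separated_of_isUIBF hinj hμ hU)
  · intro r δ μ hδ hr hμ
    obtain ⟨l, rfl⟩ : ∃ l, μ = l + 1 := ⟨μ - 1, by omega⟩
    have hl : 0 < l := by omega
    obtain ⟨c, hc, q₀, hq₀⟩ := exists_deletion_parameters r δ l hr hδ hl
    -- Deletion may cost half of the rows. Reserving `r` rather than `r - v` points for the `α t`
    -- made `c` and `q₀` independent of `v`.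
    refine ⟨c / 2, by positivity, q₀, fun v hv1 hv hμδ F _ _ _ hF => ?_⟩
    obtain ⟨p, N, hp, hN0, hN, hpq, hcN⟩ := hq₀ _ hF
    obtain ⟨m, D, hD, hm⟩ := exists_evalData_separated F (v := v) hδ hl hp hN0 hN (by omega)
    refine ⟨m, D, D.isOptimalLRC_code hδ hv1 hv hμδ hD, ?_⟩
    have hcast : ((l + 1 : ℕ) : ℝ) - 1 = l := by push_cast; ring
    rw [hcast]
    have h1 : (N : ℝ) ≤ 2 * (m + 1) := by exact_mod_cast hm
    have h2 : ((m + 1 : ℕ) : ℝ) ≤ (((m + 1) * (r + δ - 1) : ℕ) : ℝ) := by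
      exact_mod_cast Nat.le_mul_of_pos_right _ (by omega)
    push_cast at h2 ⊢
    linarith
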